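/- **The coalescing tagged particle (CTP) model.** Write $e_1=(1,0,0)$ and let $\rho(v)=\left(\frac{3v}{4\pi}\right)^{1/3}$ be the radius of a ball of volume $v$ in $\mathbb R^3$. Let $\Omega$ be the set of obstacle configurations $\omega=\{(x_k,v_k)\}$ with centres $x_k\in\mathbb R^3$ that are locally finite and volumes $v_k>0$, and let $\Sigma$ be the $\sigma$-algebra generated by the numbers of points of $\omega$ in Borel sets. For $\phi>0$ and a Borel probability measure $G$ of volumes with $G((-\infty,0])=0$, let $\mu_\phi$ be the law on $(\Omega,\Sigma)$ for which the centres form a Poisson process of intensity one in $\mathbb R^3$ and the volumes are independent of the centres and of each other, each distributed as $\phi v$ with $v\sim G$; that is, the law of the Poisson point process on $\mathbb R^3\times(0,\infty)$ with intensity measure $dx\otimes G_\phi$, where $G_\phi$ is the image of $G$ under $v\mapsto\phi v$. Given $(Y_0,V_0)\in\mathbb R^3\times[0,\infty)$ and $\omega\in\Omega$, a tagged ball starts with centre $X=\phi^{1/3}Y_0$ and volume $V=\phi V_0$ among the resting obstacles of $\omega$, and moves as follows. * *Coalescence step.* Let $J$ be the set of the remaining obstacles in contact with the tagged ball, i.e.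 with $|X-x_k|\le\rho(V)+\rho(v_k)$. If $J\neq\emptyset$, then $(X,V)$ is replaced by $\left(\frac{VX+\sum_{k\in J}v_kx_k}{V+\sum_{k\in J}v_k},\,V+\sum_{k\in J}v_k\right)$ and the obstacles in $J$ are removed. * *Coalescence event.* Coalescence steps are repeated, without motion in between, until there is no contact. The number of steps of the $j$-th event is $m_j\in\{0,1,2,\dots\}\cup\{\infty\}$. * *Free flight.* If $m_j<\infty$, the ball then moves in the direction $e_1$ until its first contact with a remaining obstacle; the length of this flight is $l_j\in[0,\infty]$. If $l_j<\infty$, the obstacles in contact at the end of the flight (almost surely exactly one) are absorbed by a coalescence step, which is not counted in $m_{j+1}$, and the $(j+1)$-st event begins. The first event begins at the initial state. **Proposition.** For every $v_*>0$ there is $\phi_*=\phi_*(v_*)>0$ such that for every Borel probability measure $G$ with $G((-\infty,0])=0$ and $\operatorname{supp}G\subset[0,v_*]$, every $0<\phi\le\phi_*$ and every $(Y_0,V_0)\in\mathbb R^3\times[0,\infty)$ there is a set $\tilde\Omega^*\in\Sigma$ with $\mu_\phi(\tilde\Omega^*)=1$ such that for every $\omega\in\tilde\Omega^*$ there are infinitely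 many coalescence events and free flights, with $m_j<\infty$ and $0<l_j<\infty$ for all $j$, and $$\sum_{j=1}^\infty l_j=\infty .$$ -/

import Mathlib

open MeasureTheory ProbabilityTheory
open scoped ENNReal NNReal

noncomputable section

/-- Physical space `ℝ³` with its Euclidean distance. -/
abbrev Space3 : Type := EuclideanSpace ℝ (Fin 3)

/-- The direction of motion `e₁ = (1, 0, 0)` of the tagged particle. -/
def e1 : Space3 := EuclideanSpace.single 0 1

/-- The radius of a ball of `ℝ³` of volume `v`. -/
def ballRadius (v : ℝ) : ℝ := (3 / (4 * Real.pi)) ^ (1 / 3 : ℝ) * v ^ (1 / 3 : ℝ)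

/-- An obstacle configuration: a set of pairs (centre, volume) with positive volumes and
locally finite centres. -/
@[ext]
structure ObstacleConfig where
  obstacles : Set (Space3 × ℝ)
  volume_pos : ∀ p ∈ obstacles, 0 < p.2
  locally_finite : ∀ r : ℝ, {p ∈ obstacles | ‖p.1‖ ≤ r}.Finite

namespace ObstacleConfig

/-- The number of obstacles whose pair (centre, volume) lies in `B`. -/
def count (B : Set (Space3 × ℝ)) (ω : ObstacleConfig) : ℕ∞ := (ω.obstacles ∩ B).encard

/-- The σ-algebra on configurations generated by the counts of Borel sets. -/
instance : MeasurableSpace ObstacleConfig :=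
  ⨆ (B : Set (Space3 × ℝ)) (_ : MeasurableSet B), MeasurableSpace.comap (count B) inferInstance

end ObstacleConfig

/-- `μ` is the law of the Poisson point process with intensity measure `Λ`: the number of points
in a Borel set of finite intensity is Poisson distributed with mean the intensity of that set, and
the numbers of points in pairwise disjoint Borel sets are independent. -/
structure IsPoissonProcessLaw (Λ : Measure (Space3 × ℝ)) (μ : Measure ObstacleConfig) : Prop where
  isProbabilityMeasure : IsProbabilityMeasure μ
  count_law : ∀ B : Set (Space3 × ℝ), MeasurableSet B → Λ B ≠ ∞ → ∀ k : ℕ,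
    μ {ω | ω.count B = k} = poissonMeasure (Λ B).toNNReal {k}
  count_indep : ∀ (n : ℕ) (B : Fin n → Set (Space3 × ℝ)), (∀ i, MeasurableSet (B i)) →
    Pairwise (fun i j => Disjoint (B i) (B j)) →
      iIndepFun (fun i => ObstacleConfig.count (B i)) μ

/-- `μ` is the law `μ_φ` of the obstacles: the centres form a Poisson process of intensity one in
`ℝ³`, and the volumes are independent of the centres and of each other, each being `φ` times a
variable of law `G`; i.e. the marked Poisson process with intensity `dx ⊗ (1/φ) G(v/φ) dv`. -/
def IsObstacleLaw (φ : ℝ) (G : Measure ℝ) (μ : Measure ObstacleConfig) : Prop :=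
  IsPoissonProcessLaw ((volume : Measure Space3).prod (G.map (fun v => φ * v))) μ

/-- A state of the system: centre and volume of the tagged particle, and the obstacles that it has
not absorbed yet. The obstacles are at rest and the tagged particle moves in direction `e₁`. -/
structure CTPState where
  center : Space3
  vol : ℝ
  remaining : Set (Space3 × ℝ)

namespace CTPState

/-- The obstacles that touch or overlap the tagged particle. -/
def contacts (s : CTPState) : Set (Space3 × ℝ) :=
  {p ∈ s.remaining | dist s.center p.1 ≤ ballRadius s.vol + ballRadius p.2}

/-- One coalescence step: the tagged particle absorbs all the obstacles in contact with it; its new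
volume is the total volume and its new centre `(V X + ∑ vₖ xₖ) / (V + ∑ vₖ)` is the centre of
mass, written here as a displacement of `X`. Nothing changes if there is no contact. -/
def merge (s : CTPState) : CTPState where
  center := s.center +
    (s.vol + ∑ᶠ p ∈ s.contacts, p.2)⁻¹ • ∑ᶠ p ∈ s.contacts, p.2 • (p.1 - s.center)
  vol := s.vol + ∑ᶠ p ∈ s.contacts, p.2
  remaining := s.remaining \ s.contacts

/-- The number of steps of the coalescence event that starts in `s`: the number of coalescence
steps before the tagged particle is free of contacts, and `⊤` if that never happens. -/
def eventSteps (s : CTPState) : ℕ∞ :=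
  ⨅ (n : ℕ) (_ : (merge^[n] s).contacts = ∅), (n : ℕ∞)

/-- The state at the end of the coalescence event that starts in `s` (meaningful if the event is
finite). -/
def afterEvent (s : CTPState) : CTPState := merge^[s.eventSteps.toNat] s

/-- Free motion of the tagged particle over the length `l`. -/
def advance (s : CTPState) (l : ℝ) : CTPState := { s with center := s.center + l • e1 }

/-- The length of the free flight that starts in `s`: the distance to the first contact with an
obstacle, and `∞` if there is no such contact. -/
def flightLength (s : CTPState) : ℝ≥0∞ :=
  ⨅ (l : ℝ≥0) (_ : (s.advance l).contacts.Nonempty), (l : ℝ≥0∞)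

/-- From the beginning of one coalescence event to the beginning of the next: the event, the free
flight after it, and the absorption of the obstacle hit at the end of the flight. After an infinite
flight the state does not change any more. -/
def next (s : CTPState) : CTPState :=
  (s.afterEvent.advance s.afterEvent.flightLength.toReal).merge

/-- The state at the beginning of the `j`-th coalescence event (counted from `0`), for the motion
that starts in `s`. -/
def stage (s : CTPState) (j : ℕ) : CTPState := next^[j] s

/-- The number of steps `m_j` of the `j`-th coalescence event (counted from `0`). -/
def coalescenceSteps (s : CTPState) (j : ℕ) : ℕ∞ := (s.stage j).eventSteps

/-- The length `l_j` of the free flight after the `j`-th coalescence event (counted from `0`). -/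
def freeFlight (s : CTPState) (j : ℕ) : ℝ≥0∞ := (s.stage j).afterEvent.flightLength

end CTPState

/-- The initial state: the tagged particle has centre `φ^{1/3} Y₀` and volume `φ V₀`, and all the
obstacles of `ω` are present. -/
def ctpInitial (φ : ℝ) (Y₀ : Space3) (V₀ : ℝ) (ω : ObstacleConfig) : CTPState where
  center := φ ^ (1 / 3 : ℝ) • Y₀
  vol := φ * V₀
  remaining := ω.obstacles

end

open Filter Topology

namespace ObstacleConfig

/-! The number of absorbed obstacles serves as a clock: every coalescence step with a contact and
every end of a finite flight adds at least one. It therefore suffices to bound this number along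
motions whose flights have total length at most `L`. A coalescence step moves the centre by at most
six times the increase of the radius (`CTPState.norm_merge_center_sub_le`). These bounds telescope,
so all absorbed obstacles lie within `‖X₀‖ + L + 8ρ(V)` of the origin (`CTPState.MassBalance`).
Almost surely every large ball of integer radius `n` holds fewer than `20 n³` obstacles, each of
volume at most `φ v_*`. As `ρ(V)³ ≤ V`, for small `φ` this gives `V ≤ C + V/2` with `C` depending on
`L`, hence a bound on `V` and on the number absorbed (`CTPState.exists_ncard_absorbed_le`). So an
event, during which `L` is constant, cannot go on forever, and infinitely many flights cannot have
finite total length. Each flight is positive by local finiteness, and finite because the tube ahead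
holds infinitely many obstacles of volume at least some `δ > 0` (`IsObstacleLaw.ae_tube_infinite`),
of which only finitely many are gone. -/

lemma measurable_count {B : Set (Space3 × ℝ)} (hB : MeasurableSet B) : Measurable (count B) := by
  rw [measurable_iff_comap_le]
  exact le_iSup₂ (f := fun (B : Set (Space3 × ℝ)) (_ : MeasurableSet B) =>
    MeasurableSpace.comap (count B) inferInstance) B hB

end ObstacleConfig

/-! ### Tails and atoms of the Poisson distribution -/

/-- Exponential tilting with base 2: the factor `2 ^ (k - m)` is at least one. The tilted weights
sum to a multiple of `exp (2r)`. -/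
lemma poissonMeasure_singleton_le_two_pow (r : ℝ≥0) {m k : ℕ} (h : m ≤ k) :
    poissonMeasure r {k} ≤
      ENNReal.ofReal ((1 / 2) ^ m * Real.exp (-r) * ((2 * r) ^ k / k.factorial)) := by
  rw [poissonMeasure_singleton]
  apply ENNReal.ofReal_le_ofReal
  have h2 : (1 : ℝ) ≤ (1 / 2) ^ m * 2 ^ k := by
    rw [one_div, inv_pow, ← div_eq_inv_mul, le_div_iff₀ (by positivity), one_mul]
    exact pow_le_pow_right₀ (by norm_num) h
  calc Real.exp (-r) * r ^ k / k.factorial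
      ≤ ((1 / 2) ^ m * 2 ^ k) * (Real.exp (-r) * r ^ k / k.factorial) :=
        le_mul_of_one_le_left (by positivity) h2
    _ = _ := by rw [mul_pow]; ring

/-- Chernoff bound for the upper tail of the Poisson distribution. -/
lemma tsum_poissonMeasure_tail_le (r : ℝ≥0) (m : ℕ) :
    ∑' k : ℕ, poissonMeasure r {m + k} ≤ ENNReal.ofReal ((1 / 2) ^ m * Real.exp r) := by
  have hs : HasSum (fun k : ℕ => (1 / 2 : ℝ) ^ m * Real.exp (-r) * ((2 * r) ^ k / k.factorial))
      ((1 / 2) ^ m * Real.exp (-r) * Real.exp (2 * r)) := by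
    have := NormedSpace.expSeries_div_hasSum_exp (2 * r : ℝ)
    rw [← Real.exp_eq_exp_ℝ] at this
    exact this.mul_left _
  have he : (1 / 2 : ℝ) ^ m * Real.exp r = (1 / 2) ^ m * Real.exp (-r) * Real.exp (2 * r) := by
    rw [mul_assoc, ← Real.exp_add]; congr 2; ring
  calc ∑' k : ℕ, poissonMeasure r {m + k}
      ≤ ∑' k : ℕ, ENNReal.ofReal ((1 / 2) ^ m * Real.exp (-r) *
          ((2 * r) ^ (m + k) / (m + k).factorial)) :=
        ENNReal.tsum_le_tsum fun k => poissonMeasure_singleton_le_two_pow r (Nat.le_add_right m k)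
    _ ≤ ∑' k : ℕ, ENNReal.ofReal ((1 / 2) ^ m * Real.exp (-r) * ((2 * r) ^ k / k.factorial)) :=
        ENNReal.tsum_comp_le_tsum_of_injective (add_right_injective m) _
    _ = _ := by
        rw [← ENNReal.ofReal_tsum_of_nonneg (fun k => by positivity) hs.summable, hs.tsum_eq, he]

lemma tendsto_poissonMeasure_singleton_atTop (k : ℕ) :
    Tendsto (fun r : ℝ≥0 => poissonMeasure r {k}) atTop (𝓝 0) := by
  simp_rw [poissonMeasure_singleton]
  rw [← ENNReal.ofReal_zero]
  refine (ENNReal.continuous_ofReal.tendsto 0).comp ?_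
  have h := ((Real.tendsto_pow_mul_exp_neg_atTop_nhds_zero k).div_const (k.factorial : ℝ)).comp
    (NNReal.tendsto_coe_atTop.2 (tendsto_id (α := ℝ≥0)))
  simpa [Function.comp_def, mul_comm] using h

/-! ### Counts of a Poisson process in null, infinite and bounded sets -/

namespace IsPoissonProcessLaw

variable {Λ : Measure (Space3 × ℝ)} {μ : Measure ObstacleConfig}

lemma ae_inter_eq_empty (h : IsPoissonProcessLaw Λ μ) {B : Set (Space3 × ℝ)}
    (hB : MeasurableSet B) (h0 : Λ B = 0) : ∀ᵐ ω ∂μ, ω.obstacles ∩ B = ∅ := by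
  have := h.isProbabilityMeasure
  have h1 := h.count_law B hB (by simp [h0]) 0
  rw [h0, poissonMeasure_singleton] at h1
  have h2 : ∀ᵐ ω ∂μ, ω.count B = 0 := by
    refine (mem_ae_iff_prob_eq_one
      (ObstacleConfig.measurable_count hB (measurableSet_singleton 0))).2 ?_
    exact h1.trans (by simp)
  filter_upwards [h2] with ω hω
  simpa [ObstacleConfig.count] using hω

/-- Infinitely many points lie in a set of infinite intensity. -/
lemma ae_inter_infinite [SigmaFinite Λ] (h : IsPoissonProcessLaw Λ μ) {T : Set (Space3 × ℝ)}
    (hT : MeasurableSet T) (hinf : Λ T = ∞) : ∀ᵐ ω ∂μ, (ω.obstacles ∩ T).Infinite := by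
  have key : ∀ k : ℕ, μ {ω | ω.count T ≤ k} = 0 := by
    intro k
    -- The Poisson law is available only for finite intensity, so `T` is exhausted by sets of finite
    -- intensity tending to infinity; the probability of at most `k` points in them tends to 0.
    set B : ℕ → Set (Space3 × ℝ) := fun n => T ∩ spanningSets Λ n with hBdef
    have hBm : ∀ n, MeasurableSet (B n) := fun n => hT.inter (measurableSet_spanningSets Λ n)
    have hBf : ∀ n, Λ (B n) ≠ ∞ := fun n =>
      ((measure_mono Set.inter_subset_right).trans_lt (measure_spanningSets_lt_top Λ n)).ne
    have hlim : Tendsto (fun n => Λ (B n)) atTop (𝓝 ∞) := by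
      have := tendsto_measure_iUnion_atTop (μ := Λ) (s := B)
        (fun a b hab => Set.inter_subset_inter_right _ (monotone_spanningSets Λ hab))
      rwa [← Set.inter_iUnion, iUnion_spanningSets, Set.inter_univ, hinf] at this
    have hlim' : Tendsto (fun n => (Λ (B n)).toNNReal) atTop atTop := by
      rw [← ENNReal.tendsto_coe_nhds_top]
      simpa [ENNReal.coe_toNNReal (hBf _)] using hlim
    have hle : ∀ n, μ {ω | ω.count T ≤ k} ≤
        ∑ j ∈ Finset.range (k + 1), poissonMeasure (Λ (B n)).toNNReal {j} := by
      intro n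
      calc μ {ω | ω.count T ≤ k}
          ≤ μ (⋃ j ∈ Finset.range (k + 1), {ω | ω.count (B n) = (j : ℕ)}) := by
            apply measure_mono
            intro ω hω
            have h1 : ω.count (B n) ≤ k := le_trans
              (Set.encard_le_encard (Set.inter_subset_inter_right _ Set.inter_subset_left)) hω
            obtain ⟨j, hj⟩ := ENat.ne_top_iff_exists.1 (ne_top_of_le_ne_top (by simp) h1)
            have hjk : j ≤ k := by rw [← hj] at h1; exact_mod_cast h1
            simp only [Set.mem_iUnion, Finset.mem_range, Set.mem_ofPred_eq]
            exact ⟨j, Nat.lt_succ_of_le hjk, hj.symm⟩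
        _ ≤ ∑ j ∈ Finset.range (k + 1), μ {ω | ω.count (B n) = (j : ℕ)} :=
            measure_biUnion_finset_le _ _
        _ = _ := Finset.sum_congr rfl fun j _ => h.count_law _ (hBm n) (hBf n) j
    have hz : Tendsto (fun n => ∑ j ∈ Finset.range (k + 1),
        poissonMeasure (Λ (B n)).toNNReal {j}) atTop (𝓝 0) := by
      have := tendsto_finsetSum (Finset.range (k + 1)) fun j _ =>
        (tendsto_poissonMeasure_singleton_atTop j).comp hlim'
      simpa using this
    exact le_antisymm (ge_of_tendsto' hz hle) zero_le
  have hall : ∀ᵐ ω ∂μ, ∀ k : ℕ, ¬ ω.count T ≤ (k : ℕ∞) := by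
    rw [ae_all_iff]
    intro k
    rw [ae_iff]
    simpa using key k
  filter_upwards [hall] with ω hω hfin
  obtain ⟨k, hk⟩ := ENat.ne_top_iff_exists.1 (Set.encard_ne_top_iff.2 hfin)
  exact hω k hk.ge

/-- Upper tail of the number of points in a bounded set. -/
lemma measure_le_count (h : IsPoissonProcessLaw Λ μ) {B : Set (Space3 × ℝ)}
    (hB : MeasurableSet B) (hfin : Λ B ≠ ∞) {r : ℝ} (hr : ∀ p ∈ B, ‖p.1‖ ≤ r) (m : ℕ) :
    μ {ω | (m : ℕ∞) ≤ ω.count B} ≤ ENNReal.ofReal ((1 / 2) ^ m * Real.exp (Λ B).toReal) := by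
  calc μ {ω | (m : ℕ∞) ≤ ω.count B} ≤ μ (⋃ k : ℕ, {ω | ω.count B = (m + k : ℕ)}) := by
        apply measure_mono
        intro ω hω
        have hf : (ω.obstacles ∩ B).Finite :=
          (ω.locally_finite r).subset fun p hp => ⟨hp.1, hr p hp.2⟩
        obtain ⟨j, hj⟩ := ENat.ne_top_iff_exists.1 (Set.encard_ne_top_iff.2 hf)
        have hj' : ω.count B = j := hj.symm
        simp only [Set.mem_ofPred_eq, hj', Nat.cast_le] at hω
        obtain ⟨k, rfl⟩ := Nat.exists_eq_add_of_le hω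
        exact Set.mem_iUnion.2 ⟨k, hj'⟩
    _ ≤ ∑' k : ℕ, μ {ω | ω.count B = (m + k : ℕ)} := measure_iUnion_le _
    _ = ∑' k : ℕ, poissonMeasure (Λ B).toNNReal {m + k} :=
        tsum_congr fun k => h.count_law B hB hfin (m + k)
    _ ≤ _ := tsum_poissonMeasure_tail_le _ m

end IsPoissonProcessLaw

/-! ### Almost sure volume bound and growth of the number of obstacles -/

namespace IsObstacleLaw

variable {φ : ℝ} {G : Measure ℝ} {μ : Measure ObstacleConfig}

lemma isProbabilityMeasure_volumeLaw [IsProbabilityMeasure G] :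
    IsProbabilityMeasure (G.map (fun v => φ * v)) :=
  Measure.isProbabilityMeasure_map (by fun_prop)

lemma ae_volume_le [IsProbabilityMeasure G] {vstar : ℝ} (hG : G (Set.Ioi vstar) = 0) (hφ : 0 < φ)
    (h : IsObstacleLaw φ G μ) : ∀ᵐ ω ∂μ, ∀ p ∈ ω.obstacles, p.2 ≤ φ * vstar := by
  have := isProbabilityMeasure_volumeLaw (φ := φ) (G := G)
  have hm : MeasurableSet (Set.univ ×ˢ Set.Ioi (φ * vstar) : Set (Space3 × ℝ)) :=
    MeasurableSet.univ.prod measurableSet_Ioi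
  have h0 : ((volume : Measure Space3).prod (G.map (fun v => φ * v)))
      (Set.univ ×ˢ Set.Ioi (φ * vstar)) = 0 := by
    rw [Measure.prod_prod, Measure.map_apply (by fun_prop) measurableSet_Ioi]
    have : (fun v => φ * v) ⁻¹' Set.Ioi (φ * vstar) = Set.Ioi vstar := by
      ext v
      exact mul_lt_mul_iff_right₀ hφ
    rw [this, hG, mul_zero]
  filter_upwards [IsPoissonProcessLaw.ae_inter_eq_empty h hm h0] with ω hω p hp
  by_contra! hlt
  exact Set.notMem_empty p (hω ▸ ⟨hp, Set.mem_univ _, hlt⟩)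

/-- Almost surely a large ball of radius `n` holds fewer than `20 n³` obstacles. -/
lemma ae_eventually_count_lt [IsProbabilityMeasure G] (h : IsObstacleLaw φ G μ) :
    ∀ᵐ ω ∂μ, ∀ᶠ n : ℕ in atTop,
      ω.count (Metric.closedBall (0 : Space3) n ×ˢ Set.univ) < ((20 * n ^ 3 : ℕ) : ℕ∞) := by
  have := isProbabilityMeasure_volumeLaw (φ := φ) (G := G)
  set Λ := (volume : Measure Space3).prod (G.map (fun v => φ * v)) with hΛ
  have hval : ∀ n : ℕ, Λ (Metric.closedBall (0 : Space3) n ×ˢ Set.univ) =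
      ENNReal.ofReal (n ^ 3 * (Real.pi * 4 / 3)) := by
    intro n
    rw [hΛ, Measure.prod_prod, measure_univ, mul_one, EuclideanSpace.volume_closedBall_fin_three,
      ← ENNReal.ofReal_pow (by positivity), ← ENNReal.ofReal_mul (by positivity)]
  have hbound : ∀ n : ℕ,
      μ {ω | ((20 * n ^ 3 : ℕ) : ℕ∞) ≤ ω.count (Metric.closedBall (0 : Space3) n ×ˢ Set.univ)} ≤
        ENNReal.ofReal ((1 / 2) ^ n) := by
    intro n
    refine (IsPoissonProcessLaw.measure_le_count h
      (Metric.isClosed_closedBall.measurableSet.prod MeasurableSet.univ)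
      (by rw [← hΛ, hval]; exact ENNReal.ofReal_ne_top) (r := n)
      (fun p hp => by simpa using hp.1) _).trans (ENNReal.ofReal_le_ofReal ?_)
    rw [← hΛ, hval, ENNReal.toReal_ofReal (by positivity)]
    -- Since `4π/3 < 5` and `e < 4`, the exponential factor is at most `2 ^ (10 n³)`. Half of the
    -- decay `2 ^ (-20 n³)` survives, which is summable, and Borel–Cantelli applies.
    have hn : (n : ℝ) ^ 3 * (Real.pi * 4 / 3) ≤ ((5 * n ^ 3 : ℕ) : ℝ) * 1 := by
      push_cast
      have := Real.pi_lt_d2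
      nlinarith [pow_nonneg (Nat.cast_nonneg (α := ℝ) n) 3]
    have hexp : Real.exp (n ^ 3 * (Real.pi * 4 / 3)) ≤ 4 ^ (5 * n ^ 3) := by
      refine (Real.exp_le_exp.2 hn).trans ?_
      rw [Real.exp_nat_mul]
      exact pow_le_pow_left₀ (Real.exp_pos 1).le
        (Real.exp_one_lt_d9.le.trans (by norm_num)) _
    have hnn : n ≤ 10 * n ^ 3 := by
      have := Nat.le_self_pow (n := 3) (by norm_num) n
      omega
    calc (1 / 2 : ℝ) ^ (20 * n ^ 3) * Real.exp (n ^ 3 * (Real.pi * 4 / 3))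
        ≤ (1 / 2 : ℝ) ^ (20 * n ^ 3) * 4 ^ (5 * n ^ 3) := by gcongr
      _ = (1 / 2) ^ (10 * n ^ 3) := by
          rw [show 20 * n ^ 3 = 4 * (5 * n ^ 3) by ring, pow_mul, ← mul_pow,
            show 10 * n ^ 3 = 2 * (5 * n ^ 3) by ring, pow_mul _ 2]
          congr 1
          norm_num
      _ ≤ (1 / 2) ^ n := pow_le_pow_of_le_one (by norm_num) (by norm_num) hnn
  have hsum : ∑' n : ℕ, μ {ω | ((20 * n ^ 3 : ℕ) : ℕ∞) ≤
      ω.count (Metric.closedBall (0 : Space3) n ×ˢ Set.univ)} ≠ ∞ := by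
    refine ne_top_of_le_ne_top ?_ (ENNReal.tsum_le_tsum hbound)
    rw [← ENNReal.ofReal_tsum_of_nonneg (fun n => by positivity) summable_geometric_two]
    exact ENNReal.ofReal_ne_top
  filter_upwards [ae_eventually_notMem hsum] with ω hω
  filter_upwards [hω] with n hn
  exact not_le.1 hn

end IsObstacleLaw

/-! ### Tubes in the direction of motion -/

/-- A half-infinite tube with square cross-section in direction `e₁`. -/
def halfTube (a b c r : ℝ) : Set Space3 :=
  {x | a < x 0 ∧ |x 1 - b| < r ∧ |x 2 - c| < r}

lemma halfTube_eq_preimage (a b c r : ℝ) :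
    halfTube a b c r = (WithLp.ofLp : Space3 → Fin 3 → ℝ) ⁻¹'
      Set.univ.pi ![Set.Ioi a, Metric.ball b r, Metric.ball c r] := by
  ext x
  simp [halfTube, Fin.forall_fin_succ, Real.dist_eq]

lemma measurableSet_univ_pi_halfTube (a b c r : ℝ) :
    MeasurableSet (Set.univ.pi ![Set.Ioi a, Metric.ball b r, Metric.ball c r]) := by
  refine MeasurableSet.univ_pi fun i => ?_
  fin_cases i
  · exact measurableSet_Ioi
  · exact Metric.isOpen_ball.measurableSet
  · exact Metric.isOpen_ball.measurableSet

lemma measurableSet_halfTube (a b c r : ℝ) : MeasurableSet (halfTube a b c r) := by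
  rw [halfTube_eq_preimage]
  exact (PiLp.volume_preserving_ofLp (Fin 3)).measurable (measurableSet_univ_pi_halfTube a b c r)

lemma volume_halfTube (a b c : ℝ) {r : ℝ} (hr : 0 < r) : volume (halfTube a b c r) = ∞ := by
  rw [halfTube_eq_preimage, (PiLp.volume_preserving_ofLp (Fin 3)).measure_preimage
    (measurableSet_univ_pi_halfTube a b c r).nullMeasurableSet, volume_pi_pi]
  simp [Fin.prod_univ_succ, hr]

/-- Volumes may be arbitrarily small, but the sets `[1/(n+1), ∞)` exhaust the positive axis, so one
of them has positive measure. -/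
lemma exists_pos_measure_Ici {ν : Measure ℝ} [NeZero ν] (hν : ν (Set.Iic 0) = 0) :
    ∃ δ : ℝ, 0 < δ ∧ ν (Set.Ici δ) ≠ 0 := by
  by_contra! hall
  have hu : (Set.univ : Set ℝ) ⊆ Set.Iic 0 ∪ ⋃ n : ℕ, Set.Ici (1 / ((n : ℝ) + 1)) := by
    intro x _
    rcases le_or_gt x 0 with hx | hx
    · exact Or.inl hx
    · obtain ⟨n, hn⟩ := exists_nat_one_div_lt hx
      exact Or.inr (Set.mem_iUnion.2 ⟨n, hn.le⟩)
  have h0 : ν Set.univ = 0 := measure_mono_null hu (measure_union_null hν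
    (measure_iUnion_null fun n => hall _ (by positivity)))
  exact NeZero.ne ν (Measure.measure_univ_eq_zero.1 h0)

/-- Almost surely every tube in direction `e₁` of a fixed width holds infinitely many obstacles of
volume at least some `δ > 0`. -/
lemma IsObstacleLaw.ae_tube_infinite {φ : ℝ} {G : Measure ℝ} {μ : Measure ObstacleConfig}
    [IsProbabilityMeasure G] (hG : G (Set.Iic 0) = 0) (hφ : 0 < φ) (h : IsObstacleLaw φ G μ) :
    ∃ δ : ℝ, 0 < δ ∧ ∀ r : ℝ, 0 < r → ∀ᵐ ω ∂μ, ∀ a b c : ℚ,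
      (ω.obstacles ∩ (halfTube a b c r ×ˢ Set.Ici δ)).Infinite := by
  have := isProbabilityMeasure_volumeLaw (φ := φ) (G := G)
  have hz : (G.map (fun v => φ * v)) (Set.Iic 0) = 0 := by
    rw [Measure.map_apply (by fun_prop) measurableSet_Iic]
    have : (fun v => φ * v) ⁻¹' Set.Iic 0 = Set.Iic 0 := by
      ext v; simp [hφ]
    rw [this, hG]
  obtain ⟨δ, hδ, hpos⟩ := exists_pos_measure_Ici hz
  refine ⟨δ, hδ, fun r hr => ?_⟩
  -- Rational tube parameters leave countably many almost sure statements; every real axis is later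
  -- approximated by a rational one.
  simp_rw [ae_all_iff]
  intro a b c
  refine IsPoissonProcessLaw.ae_inter_infinite h
    ((measurableSet_halfTube _ _ _ _).prod measurableSet_Ici) ?_
  rw [Measure.prod_prod, volume_halfTube _ _ _ hr, ENNReal.top_mul hpos]

/-! ### Inequalities for the radius -/

lemma ballRadius_nonneg {v : ℝ} (hv : 0 ≤ v) : 0 ≤ ballRadius v := by
  unfold ballRadius; positivity

lemma ballRadius_pos {v : ℝ} (hv : 0 < v) : 0 < ballRadius v := by
  unfold ballRadius; positivity

lemma ballRadius_mono {v w : ℝ} (hv : 0 ≤ v) (hvw : v ≤ w) : ballRadius v ≤ ballRadius w := by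
  unfold ballRadius; gcongr

lemma ballRadius_pow_three {v : ℝ} (hv : 0 ≤ v) :
    ballRadius v ^ 3 = 3 / (4 * Real.pi) * v := by
  rw [ballRadius, mul_pow, ← Real.rpow_natCast, ← Real.rpow_natCast, ← Real.rpow_mul (by positivity),
    ← Real.rpow_mul hv]
  norm_num

lemma ballRadius_pow_three_le {v : ℝ} (hv : 0 ≤ v) : ballRadius v ^ 3 ≤ v := by
  rw [ballRadius_pow_three hv]
  refine mul_le_of_le_one_left hv ?_
  rw [div_le_one (by positivity)]
  linarith [Real.pi_gt_three]

/-- The estimate that bounds the displacement in a coalescence step by the increase of the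
radius. -/
lemma inv_mul_sub_mul_ballRadius_le {v w : ℝ} (hv : 0 ≤ v) (hvw : v ≤ w) :
    w⁻¹ * ((w - v) * (2 * ballRadius w)) ≤ 6 * (ballRadius w - ballRadius v) := by
  have hab := ballRadius_mono hv hvw
  rcases (hv.trans hvw).eq_or_lt with hw | hw
  -- With total volume 0 the inverse is 0 by convention; this covers a tagged particle of volume 0
  -- without contacts.
  · rw [← hw]; simp only [inv_zero, zero_mul]; rw [hw]; linarith
  have hb := ballRadius_pos hw
  have ha := ballRadius_nonneg hv
  have ea := ballRadius_pow_three hv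
  have eb := ballRadius_pow_three hw.le
  set κ := 3 / (4 * Real.pi) with hκdef
  have hκ : 0 < κ := by positivity
  set a := ballRadius v
  set b := ballRadius w
  rw [inv_mul_le_iff₀ hw]
  refine le_of_mul_le_mul_left ?_ hκ
  -- In terms of the radii, `κv = a³` and `κw = b³`, so the claim is `2b(b³ - a³) ≤ 6b³(b - a)`,
  -- which follows from `a² + ab + b² ≤ 3b²`.
  have e1 : κ * ((w - v) * (2 * b)) = (b ^ 3 - a ^ 3) * (2 * b) := by rw [ea, eb]; ring
  have e2 : κ * (w * (6 * (b - a))) = b ^ 3 * (6 * (b - a)) := by rw [eb]; ring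
  rw [e1, e2]
  have h1 : a * b ≤ b ^ 2 := by nlinarith
  have h2 : a ^ 2 ≤ b ^ 2 := by nlinarith
  have h3 : 0 ≤ 2 * b * (b - a) := by nlinarith
  nlinarith [mul_le_mul_of_nonneg_left (show a ^ 2 + a * b + b ^ 2 ≤ 3 * b ^ 2 by linarith) h3]

/-! ### Contacts and free flights for a fixed obstacle set -/

/-- A locally finite set of obstacles with positive volumes that are at most `ε`. -/
structure IsObstacleSet (O : Set (Space3 × ℝ)) (ε : ℝ) : Prop where
  volume_pos : ∀ p ∈ O, 0 < p.2
  volume_le : ∀ p ∈ O, p.2 ≤ ε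
  locally_finite : ∀ r : ℝ, {p ∈ O | ‖p.1‖ ≤ r}.Finite

namespace CTPState

variable {O : Set (Space3 × ℝ)} {ε : ℝ} {s : CTPState}

/-- The obstacles that the tagged particle of state `s` touches during a flight of length at most
`l` are finite in number. -/
lemma finite_contacts_advance (hO : IsObstacleSet O ε) (hs : s.remaining ⊆ O) (l : ℝ) :
    {p ∈ s.remaining | dist s.center p.1 ≤ ballRadius s.vol + ballRadius p.2 + l}.Finite := by
  refine (hO.locally_finite (‖s.center‖ + ballRadius s.vol + ballRadius ε + l)).subset ?_
  rintro p ⟨hp, hd⟩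
  refine ⟨hs hp, ?_⟩
  have h1 := ballRadius_mono (hO.volume_pos p (hs hp)).le (hO.volume_le p (hs hp))
  have h2 : ‖p.1‖ ≤ ‖s.center‖ + dist s.center p.1 := by
    rw [dist_eq_norm]
    simpa using norm_sub_le s.center (s.center - p.1)
  linarith

lemma finite_contacts (hO : IsObstacleSet O ε) (hs : s.remaining ⊆ O) : s.contacts.Finite := by
  simpa [contacts] using finite_contacts_advance hO hs 0

lemma contacts_subset : s.contacts ⊆ s.remaining := Set.sep_subset _ _

lemma advance_advance (s : CTPState) (a b : ℝ) :
    (s.advance a).advance b = s.advance (a + b) := by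
  simp [advance, add_smul, add_assoc]

lemma norm_e1 : ‖e1‖ = 1 := by simp [e1]

/-- A state without contacts stays so for a positive flight length. -/
lemma exists_pos_forall_contacts_advance_eq_empty (hO : IsObstacleSet O ε)
    (hs : s.remaining ⊆ O) (h0 : s.contacts = ∅) :
    ∃ δ : ℝ, 0 < δ ∧ ∀ l : ℝ, 0 ≤ l → l < δ → (s.advance l).contacts = ∅ := by
  -- Only the finitely many obstacles within reach of a flight of length 1 matter; hence the minimum
  -- with 1 below.
  set F := {p ∈ s.remaining | dist s.center p.1 ≤ ballRadius s.vol + ballRadius p.2 + 1} with hF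
  have hfin : F.Finite := finite_contacts_advance hO hs 1
  have hpos : ∀ p ∈ F, ∀ᶠ l : ℝ in 𝓝 0,
      ballRadius s.vol + ballRadius p.2 + l < dist s.center p.1 := by
    intro p hp
    have hlt : ballRadius s.vol + ballRadius p.2 + 0 < dist s.center p.1 := by
      by_contra! hle
      rw [add_zero] at hle
      exact Set.notMem_empty p (h0 ▸ ⟨hp.1, hle⟩)
    exact (continuous_const.add continuous_id).tendsto' _ _ rfl |>.eventually_lt_const hlt
  obtain ⟨δ, hδ, hball⟩ := Metric.eventually_nhds_iff.1 (hfin.eventually_all.2 hpos)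
  refine ⟨min δ 1, lt_min hδ one_pos, fun l hl hlt => ?_⟩
  rw [Set.eq_empty_iff_forall_notMem]
  rintro p ⟨hp, hd⟩
  replace hd : dist (s.center + l • e1) p.1 ≤ ballRadius s.vol + ballRadius p.2 := hd
  have htri : dist s.center p.1 ≤ l + dist (s.center + l • e1) p.1 := by
    have := dist_triangle s.center (s.center + l • e1) p.1
    rwa [dist_self_add_right, norm_smul, norm_e1, mul_one, Real.norm_of_nonneg hl] at this
  have hpF : p ∈ F := ⟨hp, by linarith [hlt.trans_le (min_le_right δ 1)]⟩
  have hl0 : dist l 0 < δ := by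
    rw [Real.dist_eq, sub_zero, abs_of_nonneg hl]
    exact hlt.trans_le (min_le_left δ 1)
  have := hball hl0 p hpF
  linarith

lemma flightLength_le {l : ℝ} (hl : 0 ≤ l) (h : (s.advance l).contacts.Nonempty) :
    s.flightLength ≤ ENNReal.ofReal l := by
  refine (iInf₂_le (⟨l, hl⟩ : ℝ≥0) h).trans ?_
  rw [ENNReal.ofReal, Real.toNNReal_of_nonneg hl]
  rfl

lemma le_flightLength {δ : ℝ}
    (h : ∀ l : ℝ, 0 ≤ l → l < δ → (s.advance l).contacts = ∅) :
    ENNReal.ofReal δ ≤ s.flightLength := by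
  refine le_iInf₂ fun l hl => ?_
  rw [← ENNReal.ofReal_coe_nnreal]
  refine ENNReal.ofReal_le_ofReal (not_lt.1 fun hlt => ?_)
  exact hl.ne_empty (h l l.2 hlt)

lemma flightLength_pos (hO : IsObstacleSet O ε) (hs : s.remaining ⊆ O) (h0 : s.contacts = ∅) :
    0 < s.flightLength := by
  obtain ⟨δ, hδ, h⟩ := exists_pos_forall_contacts_advance_eq_empty hO hs h0
  exact (ENNReal.ofReal_pos.2 hδ).trans_le (le_flightLength h)

/-- At the end of a finite flight there is a contact. -/
lemma contacts_advance_flightLength_nonempty (hO : IsObstacleSet O ε) (hs : s.remaining ⊆ O)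
    (hfin : s.flightLength < ⊤) : (s.advance s.flightLength.toReal).contacts.Nonempty := by
  rw [Set.nonempty_iff_ne_empty]
  intro hempty
  -- Without a contact at the end, the flight could be prolonged by `δ`, against its definition as
  -- an infimum; so the infimum is attained.
  obtain ⟨δ, hδ, h⟩ := exists_pos_forall_contacts_advance_eq_empty (s := s.advance _) hO hs hempty
  have hle : ENNReal.ofReal (s.flightLength.toReal + δ) ≤ s.flightLength := by
    refine le_flightLength fun l hl hlt => ?_
    rcases lt_or_ge l s.flightLength.toReal with hl' | hl'
    · by_contra hne
      have h1 := ENNReal.toReal_mono ENNReal.ofReal_ne_top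
        (flightLength_le hl (Set.nonempty_iff_ne_empty.2 hne))
      rw [ENNReal.toReal_ofReal hl] at h1
      linarith
    · have := h (l - s.flightLength.toReal) (by linarith) (by linarith)
      rwa [advance_advance, add_sub_cancel] at this
  have h1 := ENNReal.toReal_mono hfin.ne hle
  rw [ENNReal.toReal_ofReal (by positivity)] at h1
  linarith

/-! ### Mass balance and confinement of the absorbed obstacles -/

/-- The balance of a motion that started at `X₀` with volume `V₀` among the obstacles `O` and has
performed free flights of total length `L`. -/
structure MassBalance (O : Set (Space3 × ℝ)) (X₀ : Space3) (V₀ L : ℝ) (s : CTPState) : Prop where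
  remaining_subset : s.remaining ⊆ O
  finite_absorbed : (O \ s.remaining).Finite
  vol_eq : s.vol = V₀ + ∑ᶠ p ∈ O \ s.remaining, p.2
  le_vol : V₀ ≤ s.vol
  norm_center_le : ‖s.center‖ ≤ ‖X₀‖ + L + 6 * ballRadius s.vol
  norm_absorbed_le : ∀ p ∈ O \ s.remaining, ‖p.1‖ ≤ ‖X₀‖ + L + 8 * ballRadius s.vol

variable {X₀ : Space3} {V₀ L : ℝ}

lemma MassBalance.advance (h : MassBalance O X₀ V₀ L s) {l : ℝ} (hl : 0 ≤ l) :
    MassBalance O X₀ V₀ (L + l) (s.advance l) where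
  remaining_subset := h.remaining_subset
  finite_absorbed := h.finite_absorbed
  vol_eq := h.vol_eq
  le_vol := h.le_vol
  norm_center_le := by
    have h1 : ‖s.center + l • e1‖ ≤ ‖s.center‖ + l := by
      refine (norm_add_le _ _).trans ?_
      rw [norm_smul, norm_e1, mul_one, Real.norm_of_nonneg hl]
    have := h.norm_center_le
    simp only [CTPState.advance]
    linarith
  norm_absorbed_le p hp := by
    have := h.norm_absorbed_le p hp
    simp only [CTPState.advance]
    linarith

/-- The displacement in a coalescence step is controlled by the increase of the radius. -/
lemma norm_merge_center_sub_le (hO : IsObstacleSet O ε) (hs : s.remaining ⊆ O) (hv : 0 ≤ s.vol) :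
    ‖s.merge.center - s.center‖ ≤ 6 * (ballRadius s.merge.vol - ballRadius s.vol) := by
  have hfin := finite_contacts hO hs
  have hpos : ∀ p ∈ hfin.toFinset, 0 ≤ p.2 := fun p hp =>
    (hO.volume_pos p (hs (contacts_subset (hfin.mem_toFinset.1 hp)))).le
  have hvol : s.merge.vol = s.vol + ∑ p ∈ hfin.toFinset, p.2 := by
    rw [merge, finsum_mem_eq_finite_toFinset_sum _ hfin]
  have hle : s.vol ≤ s.merge.vol := by
    rw [hvol]; linarith [Finset.sum_nonneg hpos]
  have hc : s.merge.center - s.center =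
      s.merge.vol⁻¹ • ∑ p ∈ hfin.toFinset, p.2 • (p.1 - s.center) := by
    rw [hvol, merge, finsum_mem_eq_finite_toFinset_sum _ hfin,
      finsum_mem_eq_finite_toFinset_sum _ hfin]
    simp
  refine le_trans ?_ (inv_mul_sub_mul_ballRadius_le hv hle)
  rw [hc, norm_smul, norm_inv, Real.norm_of_nonneg (hv.trans hle)]
  refine mul_le_mul_of_nonneg_left ?_ (inv_nonneg.2 (hv.trans hle))
  rw [show s.merge.vol - s.vol = ∑ p ∈ hfin.toFinset, p.2 by rw [hvol]; ring, Finset.sum_mul]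
  refine norm_sum_le_of_le _ fun p hp => ?_
  rw [norm_smul, Real.norm_of_nonneg (hpos p hp)]
  refine mul_le_mul_of_nonneg_left ?_ (hpos p hp)
  have h1 : ‖p.1 - s.center‖ ≤ ballRadius s.vol + ballRadius p.2 := by
    rw [← dist_eq_norm, dist_comm]; exact (hfin.mem_toFinset.1 hp).2
  have h2 : p.2 ≤ s.merge.vol := by
    rw [hvol]; linarith [Finset.single_le_sum hpos hp]
  linarith [ballRadius_mono hv hle, ballRadius_mono (hpos p hp) h2]

lemma diff_merge_remaining (hs : s.remaining ⊆ O) :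
    O \ s.merge.remaining = (O \ s.remaining) ∪ s.contacts := by
  have := contacts_subset (s := s)
  ext p
  have h1 : p ∈ s.contacts → p ∈ O := fun h => hs (this h)
  simp only [merge, Set.mem_sdiff, Set.mem_union]
  tauto

lemma disjoint_absorbed_contacts : Disjoint (O \ s.remaining) s.contacts :=
  Set.disjoint_left.2 fun _ hp hc => hp.2 (contacts_subset hc)

/-- The displacement bound telescopes into `6ρ(V)`, whatever the number of steps. A newly absorbed
centre is within the sum of two radii, each at most the new `ρ(V)`, of the old centre, whence `8 = 6
+ 2`. Bounds for earlier obstacles persist because the radius does not decrease. -/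
lemma MassBalance.merge (hO : IsObstacleSet O ε) (hV₀ : 0 ≤ V₀)
    (h : MassBalance O X₀ V₀ L s) : MassBalance O X₀ V₀ L s.merge := by
  have hs := h.remaining_subset
  have hfin := finite_contacts hO hs
  have hv : 0 ≤ s.vol := hV₀.trans h.le_vol
  have hpos : ∀ p ∈ hfin.toFinset, 0 ≤ p.2 := fun p hp =>
    (hO.volume_pos p (hs (contacts_subset (hfin.mem_toFinset.1 hp)))).le
  have hvol : s.merge.vol = s.vol + ∑ p ∈ hfin.toFinset, p.2 := by
    rw [CTPState.merge, finsum_mem_eq_finite_toFinset_sum _ hfin]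
  have hle : s.vol ≤ s.merge.vol := by
    rw [hvol]; linarith [Finset.sum_nonneg hpos]
  have hr := ballRadius_mono hv hle
  refine ⟨Set.sdiff_subset.trans hs, ?_, ?_, h.le_vol.trans hle, ?_, ?_⟩
  · rw [diff_merge_remaining hs]
    exact h.finite_absorbed.union hfin
  · rw [diff_merge_remaining hs, finsum_mem_union disjoint_absorbed_contacts h.finite_absorbed hfin,
      ← add_assoc, ← h.vol_eq]
    rfl
  · have h1 := norm_merge_center_sub_le hO hs hv
    have h2 : ‖s.merge.center‖ ≤ ‖s.center‖ + ‖s.merge.center - s.center‖ := by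
      simpa using norm_add_le s.center (s.merge.center - s.center)
    linarith [h.norm_center_le]
  · intro p hp
    rw [diff_merge_remaining hs] at hp
    rcases hp with hp | hp
    · linarith [h.norm_absorbed_le p hp]
    · have hp' := hfin.mem_toFinset.2 hp
      have h1 : ‖p.1 - s.center‖ ≤ ballRadius s.vol + ballRadius p.2 := by
        rw [← dist_eq_norm, dist_comm]; exact hp.2
      have h2 : p.2 ≤ s.merge.vol := by
        rw [hvol]; linarith [Finset.single_le_sum hpos hp']
      have h3 : ‖p.1‖ ≤ ‖s.center‖ + ‖p.1 - s.center‖ := by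
        simpa using norm_add_le s.center (p.1 - s.center)
      linarith [h.norm_center_le, ballRadius_mono (hpos p hp') h2]

lemma MassBalance.merge_iterate (hO : IsObstacleSet O ε) (hV₀ : 0 ≤ V₀)
    (h : MassBalance O X₀ V₀ L s) (n : ℕ) : MassBalance O X₀ V₀ L (CTPState.merge^[n] s) := by
  induction n with
  | zero => exact h
  | succ n ih => rw [Function.iterate_succ_apply']; exact ih.merge hO hV₀

lemma ncard_absorbed_lt_merge (hO : IsObstacleSet O ε) (h : MassBalance O X₀ V₀ L s)
    (hne : s.contacts.Nonempty) :
    (O \ s.remaining).ncard < (O \ s.merge.remaining).ncard := by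
  have hfin := finite_contacts hO h.remaining_subset
  rw [diff_merge_remaining h.remaining_subset,
    Set.ncard_union_eq disjoint_absorbed_contacts h.finite_absorbed hfin]
  have := (Set.ncard_pos hfin).2 hne
  omega

lemma ncard_absorbed_le_merge (hO : IsObstacleSet O ε) (h : MassBalance O X₀ V₀ L s) :
    (O \ s.remaining).ncard ≤ (O \ s.merge.remaining).ncard := by
  have hfin := finite_contacts hO h.remaining_subset
  rw [diff_merge_remaining h.remaining_subset,
    Set.ncard_union_eq disjoint_absorbed_contacts h.finite_absorbed hfin]
  omega

lemma ncard_absorbed_le_merge_iterate (hO : IsObstacleSet O ε) (hV₀ : 0 ≤ V₀)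
    (h : MassBalance O X₀ V₀ L s) (n : ℕ) :
    (O \ s.remaining).ncard ≤ (O \ (merge^[n] s).remaining).ncard := by
  induction n with
  | zero => rfl
  | succ n ih =>
    rw [Function.iterate_succ_apply']
    exact ih.trans (ncard_absorbed_le_merge hO (h.merge_iterate hO hV₀ n))

/-! ### Bounded absorption and global motion -/

/-- Moderate growth of the number of obstacles bounds the number of obstacles that can be absorbed
along a motion with free flights of total length at most `L`. -/
lemma exists_ncard_absorbed_le (hO : IsObstacleSet O ε) (hε : 2048 * 20 * ε ≤ 1 / 2)
    (hV₀ : 0 ≤ V₀) (X₀ : Space3)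
    (hcount : ∀ᶠ n : ℕ in atTop, {p ∈ O | ‖p.1‖ ≤ n}.ncard ≤ 20 * n ^ 3) (L : ℝ) :
    ∃ N : ℕ, ∀ L' : ℝ, 0 ≤ L' → L' ≤ L → ∀ s : CTPState, MassBalance O X₀ V₀ L' s →
      (O \ s.remaining).ncard ≤ N := by
  rcases le_or_gt ε 0 with hε0 | hε0
  · refine ⟨0, fun L' _ _ s _ => ?_⟩
    have : O = ∅ := by
      rw [Set.eq_empty_iff_forall_notMem]
      intro p hp
      linarith [hO.volume_pos p hp, hO.volume_le p hp]
    simp [this]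
  obtain ⟨n₀, hn₀⟩ := eventually_atTop.1 hcount
  -- The term `n₀ + 1` pays for an integer radius that is at least `n₀`, where the growth bound
  -- holds. `W` solves `W = V₀ + 80εM³ + W/2`.
  set M : ℝ := ‖X₀‖ + L + n₀ + 1 with hM
  set W : ℝ := 2 * (V₀ + 80 * ε * M ^ 3) with hW
  refine ⟨⌈20 * (M + 8 * ballRadius W) ^ 3⌉₊, fun L' hL0 hL' s hs => ?_⟩
  have hL : 0 ≤ L := hL0.trans hL'
  have hM0 : 0 ≤ M := by positivity
  have hv : 0 ≤ s.vol := hV₀.trans hs.le_vol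
  have hr := ballRadius_nonneg hv
  have hcard : ((O \ s.remaining).ncard : ℝ) ≤ 20 * (M + 8 * ballRadius s.vol) ^ 3 := by
    set n : ℕ := n₀ + ⌈‖X₀‖ + L + 8 * ballRadius s.vol⌉₊ with hn
    have hle : ‖X₀‖ + L + 8 * ballRadius s.vol ≤ n := by
      have := Nat.le_ceil (‖X₀‖ + L + 8 * ballRadius s.vol)
      rw [hn]; push_cast; linarith [Nat.cast_nonneg (α := ℝ) n₀]
    have hnle : (n : ℝ) ≤ M + 8 * ballRadius s.vol := by
      have := Nat.ceil_lt_add_one (show 0 ≤ ‖X₀‖ + L + 8 * ballRadius s.vol by positivity)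
      rw [hn]; push_cast; linarith
    have hsub : O \ s.remaining ⊆ {p ∈ O | ‖p.1‖ ≤ n} := fun p hp =>
      ⟨hp.1, by linarith [hs.norm_absorbed_le p hp]⟩
    have h1 : (O \ s.remaining).ncard ≤ 20 * n ^ 3 :=
      (Set.ncard_le_ncard hsub (hO.locally_finite n)).trans (hn₀ n (by omega))
    calc ((O \ s.remaining).ncard : ℝ) ≤ 20 * (n : ℝ) ^ 3 := by exact_mod_cast h1
      _ ≤ _ := by gcongr
  have hvol : s.vol ≤ V₀ + (O \ s.remaining).ncard * ε := by
    rw [hs.vol_eq, finsum_mem_eq_finite_toFinset_sum _ hs.finite_absorbed,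
      Set.ncard_eq_toFinset_card _ hs.finite_absorbed, ← nsmul_eq_mul]
    gcongr
    exact Finset.sum_le_card_nsmul _ _ _ fun p hp =>
      hO.volume_le p (hs.finite_absorbed.mem_toFinset.1 hp).1
  have hvW : s.vol ≤ W := by
    have hcube : (M + 8 * ballRadius s.vol) ^ 3 ≤ 4 * (M ^ 3 + 512 * s.vol) := by
      have h3 := ballRadius_pow_three_le hv
      have : (M + 8 * ballRadius s.vol) ^ 3 ≤ 4 * (M ^ 3 + (8 * ballRadius s.vol) ^ 3) := by
        have := add_pow_le hM0 (show 0 ≤ 8 * ballRadius s.vol by positivity) 3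
        norm_num at this ⊢
        linarith
      nlinarith
    have h4 : ((O \ s.remaining).ncard : ℝ) * ε ≤ 20 * (4 * (M ^ 3 + 512 * s.vol)) * ε := by
      gcongr
      linarith
    -- `20 · 4 · 512 = 2048 · 20` is the coefficient of `ε * s.vol` in the preceding bound, so
    -- smallness of `ε` lets half of the volume be absorbed on the left.
    have h5 : 2048 * 20 * ε * s.vol ≤ 1 / 2 * s.vol := mul_le_mul_of_nonneg_right hε hv
    rw [hW]
    nlinarith
  have hfinal : ((O \ s.remaining).ncard : ℝ) ≤ 20 * (M + 8 * ballRadius W) ^ 3 := by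
    have := ballRadius_mono hv hvW
    refine hcard.trans ?_
    gcongr
  exact_mod_cast hfinal.trans (Nat.le_ceil _)

/-- A bound on the number of absorbed obstacles makes a coalescence event finite. -/
lemma eventSteps_lt_top (hO : IsObstacleSet O ε) (hV₀ : 0 ≤ V₀) (h : MassBalance O X₀ V₀ L s)
    {N : ℕ} (hN : ∀ s : CTPState, MassBalance O X₀ V₀ L s → (O \ s.remaining).ncard ≤ N) :
    s.eventSteps < ⊤ := by
  by_contra htop
  have hne : ∀ n : ℕ, (merge^[n] s).contacts.Nonempty := by
    intro n
    rw [Set.nonempty_iff_ne_empty]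
    intro he
    exact htop ((iInf₂_le n he).trans_lt (ENat.natCast_lt_top n))
  have hgrow : ∀ n : ℕ, n ≤ (O \ (merge^[n] s).remaining).ncard := by
    intro n
    induction n with
    | zero => exact Nat.zero_le _
    | succ n ih =>
      rw [Function.iterate_succ_apply']
      exact ih.trans_lt (ncard_absorbed_lt_merge hO (h.merge_iterate hO hV₀ n) (hne n))
  have := (hgrow (N + 1)).trans (hN _ (h.merge_iterate hO hV₀ _))
  omega

/-- A finite infimum over natural numbers is attained. Finiteness is essential, since `toNat` would
turn an infinite event into 0 steps. -/
lemma contacts_afterEvent_eq_empty (h : s.eventSteps < ⊤) : s.afterEvent.contacts = ∅ := by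
  have hex : ∃ n : ℕ, (merge^[n] s).contacts = ∅ := by
    by_contra! hne
    refine h.ne ?_
    simp only [eventSteps, iInf_eq_top]
    exact fun n hn => absurd hn (hne n).ne_empty
  classical
  have hfind : s.eventSteps = (Nat.find hex : ℕ) := by
    refine le_antisymm (iInf₂_le (Nat.find hex) (Nat.find_spec hex)) (le_iInf₂ fun n hn => ?_)
    exact_mod_cast Nat.find_min' hex hn
  rw [afterEvent, hfind, ENat.toNat_natCast]
  exact Nat.find_spec hex

/-- The set `O` has, in front of every point, infinitely many obstacles whose distance from the axis
of motion through the point is at most their radius. -/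
def HasForwardObstacles (O : Set (Space3 × ℝ)) : Prop :=
  ∀ x : Space3, {p ∈ O | ∃ l : ℝ, 0 ≤ l ∧ dist (x + l • e1) p.1 ≤ ballRadius p.2}.Infinite

/-- Removing finitely many obstacles leaves one that meets the axis of motion ahead, and it is hit
even by a particle of volume 0. -/
lemma flightLength_lt_top (hfwd : HasForwardObstacles O) (hfin : (O \ s.remaining).Finite)
    (hv : 0 ≤ s.vol) : s.flightLength < ⊤ := by
  obtain ⟨p, ⟨hpO, l, hl, hd⟩, hp⟩ := ((hfwd s.center).sdiff hfin).nonempty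
  have hrem : p ∈ s.remaining := by
    by_contra hn
    exact hp ⟨hpO, hn⟩
  refine (flightLength_le hl ⟨p, hrem, ?_⟩).trans_lt ENNReal.ofReal_lt_top
  refine hd.trans ?_
  have := ballRadius_nonneg hv
  simp only [advance]
  linarith

/-- The conclusion for a fixed obstacle set: finite events, positive finite flights, and infinite
total flight length. -/
theorem motion_is_global (hO : IsObstacleSet O ε) (hε : 2048 * 20 * ε ≤ 1 / 2)
    (hcount : ∀ᶠ n : ℕ in atTop, {p ∈ O | ‖p.1‖ ≤ n}.ncard ≤ 20 * n ^ 3)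
    (hfwd : HasForwardObstacles O) (hv : 0 ≤ s.vol) (hs : s.remaining = O) :
    (∀ j : ℕ, s.coalescenceSteps j < ⊤) ∧
      (∀ j : ℕ, 0 < s.freeFlight j ∧ s.freeFlight j < ⊤) ∧ ∑' j : ℕ, s.freeFlight j = ⊤ := by
  have hinit : MassBalance O s.center s.vol 0 s := by
    refine ⟨hs.subset, ?_, ?_, le_rfl, ?_, ?_⟩
    · simp [hs]
    · simp [hs]
    · linarith [ballRadius_nonneg hv]
    · simp [hs]
  have hbound := exists_ncard_absorbed_le hO hε hv s.center hcount
  have hevent : ∀ {L : ℝ} {t : CTPState}, 0 ≤ L → MassBalance O s.center s.vol L t →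
      t.eventSteps < ⊤ := by
    intro L t hL ht
    obtain ⟨N, hN⟩ := hbound L
    exact eventSteps_lt_top hO hv ht fun t ht => hN L hL le_rfl t ht
  have hflight : ∀ {L : ℝ} {t : CTPState}, MassBalance O s.center s.vol L t →
      t.afterEvent.flightLength < ⊤ := fun {L t} ht =>
    flightLength_lt_top hfwd (ht.merge_iterate hO hv _).finite_absorbed
      (hv.trans (ht.merge_iterate hO hv _).le_vol)
  -- An event may absorb nothing; the count grows with `j` because of the obstacle hit at the end of
  -- each flight.
  have hstage : ∀ j : ℕ,
      MassBalance O s.center s.vol (∑ i ∈ Finset.range j, (s.freeFlight i).toReal) (s.stage j) ∧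
        j ≤ (O \ (s.stage j).remaining).ncard := by
    intro j
    induction j with
    | zero => exact ⟨by simpa [stage] using hinit, Nat.zero_le _⟩
    | succ j ih =>
      obtain ⟨hb, hj⟩ := ih
      have hae : MassBalance O s.center s.vol _ (s.stage j).afterEvent := hb.merge_iterate hO hv _
      have hadv := hae.advance (ENNReal.toReal_nonneg (a := s.freeFlight j))
      have hnext : s.stage (j + 1) =
          ((s.stage j).afterEvent.advance (s.freeFlight j).toReal).merge := by
        rw [stage, Function.iterate_succ_apply']; rfl
      rw [Finset.sum_range_succ, hnext]
      refine ⟨hadv.merge hO hv, ?_⟩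
      have h1 : (O \ (s.stage j).remaining).ncard ≤ (O \ (s.stage j).afterEvent.remaining).ncard :=
        ncard_absorbed_le_merge_iterate hO hv hb _
      have h2 := ncard_absorbed_lt_merge hO hadv
        (contacts_advance_flightLength_nonempty hO hae.remaining_subset (hflight hb))
      exact (hj.trans h1).trans_lt h2
  have hL : ∀ j, 0 ≤ ∑ i ∈ Finset.range j, (s.freeFlight i).toReal := fun j =>
    Finset.sum_nonneg fun i _ => ENNReal.toReal_nonneg
  have hm : ∀ j : ℕ, s.coalescenceSteps j < ⊤ := fun j => hevent (hL j) (hstage j).1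
  refine ⟨hm, fun j => ⟨?_, hflight (hstage j).1⟩, ?_⟩
  · exact flightLength_pos hO ((hstage j).1.merge_iterate hO hv _).remaining_subset
      (contacts_afterEvent_eq_empty (hm j))
  · by_contra hne
    -- If the total were finite, one `N` would bound the absorbed number at every stage, but stage
    -- `N + 1` has at least `N + 1` absorbed obstacles.
    obtain ⟨N, hN⟩ := hbound (∑' j, s.freeFlight j).toReal
    have hle : ∑ i ∈ Finset.range (N + 1), (s.freeFlight i).toReal ≤
        (∑' j, s.freeFlight j).toReal := by
      rw [← ENNReal.toReal_sum (f := s.freeFlight) fun i _ => (hflight (hstage i).1).ne]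
      exact ENNReal.toReal_mono hne (ENNReal.sum_le_tsum _)
    have := (hstage (N + 1)).2.trans (hN _ (hL _) hle _ (hstage (N + 1)).1)
    omega

end CTPState

/-! ### From tubes to forward obstacles, and the proposition -/

lemma dist_add_smul_e1_le {x y : Space3} {l r : ℝ} (h0 : x 0 + l = y 0)
    (h1 : |y 1 - x 1| ≤ r) (h2 : |y 2 - x 2| ≤ r) : dist (x + l • e1) y ≤ 2 * r := by
  have hr : 0 ≤ r := (abs_nonneg _).trans h1
  rw [EuclideanSpace.dist_eq, Real.sqrt_le_left (by positivity), Fin.sum_univ_three]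
  have e0 : (x + l • e1) 0 = y 0 := by simp [e1, h0]
  have e1' : (x + l • e1) 1 = x 1 := by simp [e1]
  have e2 : (x + l • e1) 2 = x 2 := by simp [e1]
  rw [e0, e1', e2, dist_self, Real.dist_eq, Real.dist_eq, abs_sub_comm, abs_sub_comm (x 2)]
  nlinarith [abs_nonneg (y 1 - x 1), abs_nonneg (y 2 - x 2)]

/-- A rational axis within `ρ(δ)/4` of the given one in each transverse coordinate, and a tube of
half-width `ρ(δ)/4` around it, leave transverse offsets of at most `ρ(δ)/2`, hence a distance of at
most `ρ(δ)`. -/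
lemma CTPState.hasForwardObstacles_of_tubes {O : Set (Space3 × ℝ)} {δ : ℝ} (hδ : 0 < δ)
    (h : ∀ a b c : ℚ, (O ∩ (halfTube a b c (ballRadius δ / 4) ×ˢ Set.Ici δ)).Infinite) :
    HasForwardObstacles O := by
  intro x
  have hr := ballRadius_pos hδ
  obtain ⟨a, ha⟩ := exists_rat_gt (x 0)
  obtain ⟨b, hb⟩ := exists_rat_near (x 1) (show 0 < ballRadius δ / 4 by positivity)
  obtain ⟨c, hc⟩ := exists_rat_near (x 2) (show 0 < ballRadius δ / 4 by positivity)
  refine (h a b c).mono ?_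
  rintro p ⟨hp, ⟨h0, h1, h2⟩, hv⟩
  refine ⟨hp, p.1 0 - x 0, by linarith, ?_⟩
  have hd : dist (x + (p.1 0 - x 0) • e1) p.1 ≤ 2 * (ballRadius δ / 2) := by
    refine dist_add_smul_e1_le (by ring) ?_ ?_
    · rw [abs_lt] at hb h1
      rw [abs_le]; constructor <;> linarith
    · rw [abs_lt] at hc h2
      rw [abs_le]; constructor <;> linarith
  linarith [ballRadius_mono hδ.le hv]

theorem mainTheorem4 (vstar : ℝ) (hvstar : 0 < vstar) :
    ∃ φstar : ℝ, 0 < φstar ∧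
      ∀ (G : Measure ℝ), IsProbabilityMeasure G → G (Set.Iic 0) = 0 → G (Set.Ioi vstar) = 0 →
      ∀ φ : ℝ, 0 < φ → φ ≤ φstar →
      ∀ μ : Measure ObstacleConfig, IsObstacleLaw φ G μ →
      ∀ (Y₀ : Space3) (V₀ : ℝ), 0 ≤ V₀ →
      ∃ S : Set ObstacleConfig, MeasurableSet S ∧ μ S = 1 ∧ ∀ ω ∈ S,
        (∀ j : ℕ, (ctpInitial φ Y₀ V₀ ω).coalescenceSteps j < ⊤) ∧
        (∀ j : ℕ, 0 < (ctpInitial φ Y₀ V₀ ω).freeFlight j ∧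
          (ctpInitial φ Y₀ V₀ ω).freeFlight j < ⊤) ∧
        ∑' j : ℕ, (ctpInitial φ Y₀ V₀ ω).freeFlight j = ⊤ := by
  -- `81920 = 2 · 2048 · 20` is the smallness of the maximal obstacle volume `φ * vstar` needed to
  -- absorb half of the volume.
  refine ⟨1 / (81920 * vstar), by positivity, ?_⟩
  intro G hG hG0 hGv φ hφ hφle μ hμ Y₀ V₀ hV₀
  have hμp : IsProbabilityMeasure μ := hμ.isProbabilityMeasure
  obtain ⟨δ, hδ, htube⟩ := hμ.ae_tube_infinite hG0 hφ
  have hε : 2048 * 20 * (φ * vstar) ≤ 1 / 2 := by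
    rw [le_div_iff₀ (by positivity)] at hφle
    linarith
  have hae : ∀ᵐ ω ∂μ, (∀ j : ℕ, (ctpInitial φ Y₀ V₀ ω).coalescenceSteps j < ⊤) ∧
      (∀ j : ℕ, 0 < (ctpInitial φ Y₀ V₀ ω).freeFlight j ∧
        (ctpInitial φ Y₀ V₀ ω).freeFlight j < ⊤) ∧
      ∑' j : ℕ, (ctpInitial φ Y₀ V₀ ω).freeFlight j = ⊤ := by
    filter_upwards [hμ.ae_volume_le hGv hφ, hμ.ae_eventually_count_lt,
      htube (ballRadius δ / 4) (by have := ballRadius_pos hδ; positivity)] with ω hvol hcount hfwd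
    refine CTPState.motion_is_global (O := ω.obstacles)
      ⟨ω.volume_pos, hvol, ω.locally_finite⟩ hε ?_
      (CTPState.hasForwardObstacles_of_tubes hδ hfwd) (mul_nonneg hφ.le hV₀) rfl
    filter_upwards [hcount] with n hn
    have hset : {p ∈ ω.obstacles | ‖p.1‖ ≤ n} =
        ω.obstacles ∩ (Metric.closedBall (0 : Space3) n ×ˢ Set.univ) := by
      ext p; simp
    have hfin := ω.locally_finite n
    rw [ObstacleConfig.count, ← hset, ← hfin.cast_ncard_eq] at hn
    exact_mod_cast hn.le
  -- Measurability of the good event itself is not needed: the exceptional set lies in a measurable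
  -- null set.
  obtain ⟨T, hsub, hT, hT0⟩ := exists_measurable_superset_of_null (ae_iff.1 hae)
  refine ⟨Tᶜ, hT.compl, (prob_compl_eq_one_iff hT).2 hT0, fun ω hω => ?_⟩
  by_contra hn
  exact hω (hsub hn)
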